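/- Consider two parallel arcs, $1$ and $2$, linking an origin to a destination, with per-unit cost functions $c_1,c_2$ that are strictly increasing, convex and continuously differentiable on a neighbourhood of $[0,\bar M]$ and non-negative on $[0,\bar M]$. There are nonatomic players of total weight $T^0\ge 0$ and $N\ge 1$ atomic players of weights $T^1,\dots,T^N>0$; let $M=\sum_{i=0}^N T^i<\bar M$. A feasible flow for a stock of weight $w$ is a pair $(x_1,x_2)\in\mathbb R_+^2$ with $x_1+x_2=w$. If $\xi_r$ is the total weight on arc $r$, each unit of stock on arc $r$ has cost $c_r(\xi_r)$, so that an atomic player with flow $(x_1,x_2)$ pays $x_1c_1(\xi_1)+x_2c_2(\xi_2)$. A composite equilibrium (CE) is a profile of feasible flows such that every arc used by nonatomic players has minimal cost and each atomic player's flow minimizes her own cost given the other flows. Assume that either (i) $c_1(M)<c_2(0)$, or (ii) $c_1(M)\ge c_2(0)$, $c_2(M)\ge c_1(0)$, and the number $\hat\xi\in[0,M]$ with $c_1(\hat\xi)=c_2(M-\hat\xi)$ satisfies $\hat\xi\,c_1'(\hat\xi)\ge (M-\hat\xi)\,c_2'(M-\hat\xi)$. Stackelberg game: the leader, atomic player $N$,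 first chooses a feasible flow $x=(x_1,x_2)$ of weight $T^N$; then her opponents (the nonatomic players of weight $T^0$ and the atomic players $1,\dots,N-1$) play the composite congestion game in which the cost of arc $r$, when they send total weight $t$ on it, is $c_r(x_r+t)$. A subgame perfect Nash equilibrium (SPNE) consists of a flow $x^*$ and, for each feasible $x$, a CE $Z_x$ of the followers' game, such that $x^*$ minimizes over the feasible $x$ the leader's cost $\Pi^N(x)=\sum_r x_r c_r(\xi_r)$ at $(x,Z_x)$. Unilateral decentralization: player $N$ chooses a profile $\alpha=(\alpha^0,\alpha^1,\dots,\alpha^n)$, where $n\ge 0$, $\alpha^0\ge 0$, $\alpha^1\ge\dots\ge\alpha^n>0$ and $\sum_{i=0}^n\alpha^i=T^N$, and is replaced by nonatomic deputies of total weight $\alpha^0$ and $n$ atomic deputies of weights $\alpha^1,\dots,\alpha^n$, who play a composite congestion game together with her opponents (nonatomic weight $\alpha^0+T^0$, atomic weights $\alpha^1,\dots,\alpha^n,T^1,\dots,T^{N-1}$). Her cost $U^N(\alpha)$ is the total cost to her deputies at the CE of this game; $\alpha$ is optimal if it minimizes $U^N$ over all such profiles. Then the CE of the followers' game after every $x$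 and the CE of the game induced by every $\alpha$ exist and are unique, and $U^N(\alpha)$ is well defined. The Stackelberg game admits an SPNE. An optimal decentralization strategy exists, and, for every optimal $\alpha$ and every SPNE, $U^N(\alpha)$ equals player $N$'s cost $\Pi^N(x^*)$ at the SPNE. -/

import Mathlib

open Set Topology

noncomputable section

namespace CompositeCongestion

/-! Two parallel arcs, indexed by `Fin 2`: index `0` is the first arc, index `1` the second. -/

/-- Feasible flows on the two arcs for a stock of weight `w`. -/
def feasible (w : ℝ) : Set (Fin 2 → ℝ) :=
  {x | (∀ r, 0 ≤ x r) ∧ ∑ r, x r = w}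

/-- A system flow: the flow of the nonatomic players and the flow of each atomic player `i : ι`. -/
@[ext]
structure Flow (ι : Type) where
  nonatomic : Fin 2 → ℝ
  atomic : ι → Fin 2 → ℝ

namespace Flow

variable {ι : Type}

/-- Aggregate weight on arc `r`. -/
def load [Fintype ι] (z : Flow ι) (r : Fin 2) : ℝ :=
  z.nonatomic r + ∑ i, z.atomic i r

/-- Cost of atomic player `i` at the flow `z`. -/
def atomicCost [Fintype ι] (c : Fin 2 → ℝ → ℝ) (z : Flow ι) (i : ι) : ℝ :=
  ∑ r, z.atomic i r * c r (z.load r)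

/-- The flow `z` in which atomic player `i` sends the flow `y` instead. -/
def deviate [DecidableEq ι] (z : Flow ι) (i : ι) (y : Fin 2 → ℝ) : Flow ι where
  nonatomic := z.nonatomic
  atomic := Function.update z.atomic i y

end Flow

/-- `z` is a composite equilibrium of the composite congestion game with arc costs `c`, nonatomic
players of total weight `T0` and atomic players of weights `T i`. -/
structure IsCE {ι : Type} [Fintype ι] [DecidableEq ι] (c : Fin 2 → ℝ → ℝ) (T0 : ℝ) (T : ι → ℝ)
    (z : Flow ι) : Prop where
  nonatomic_mem : z.nonatomic ∈ feasible T0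
  atomic_mem : ∀ i, z.atomic i ∈ feasible (T i)
  wardrop : ∀ r, 0 < z.nonatomic r → ∀ s, c r (z.load r) ≤ c s (z.load s)
  nash : ∀ i, ∀ y ∈ feasible (T i), z.atomicCost c i ≤ (z.deviate i y).atomicCost c i

/-- A decentralization strategy of an atomic player of weight `w`: finitely many atomic deputies
of positive weights in non-increasing order, and nonatomic deputies of total weight `weight0`. -/
structure DecentralizationStrategy (w : ℝ) where
  n : ℕ
  weight0 : ℝ
  weight : Fin n → ℝ
  weight0_nonneg : 0 ≤ weight0
  weight_pos : ∀ i, 0 < weight i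
  weight_antitone : Antitone weight
  sum_eq : weight0 + ∑ i, weight i = w

/-- Data of a binary choice composite congestion game with a distinguished atomic player (the one
who may decentralize, or lead), of weight `TN`. Her opponents are nonatomic players of total weight
`T0` and `k` atomic players of weights `T j`. -/
structure Game where
  c : Fin 2 → ℝ → ℝ
  k : ℕ
  T0 : ℝ
  T : Fin k → ℝ
  TN : ℝ

namespace Game

variable (G : Game)

/-- Total weight of all the players. -/
def M : ℝ := G.T0 + ∑ j, G.T j + G.TN

/-- Assumptions on the player weights and on the arc costs; the costs are regular on a
neighbourhood `Ω` of `[0, Mbar]`, where `Mbar` exceeds the total weight. -/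
structure Admissible (Mbar : ℝ) (Ω : Set ℝ) : Prop where
  T0_nonneg : 0 ≤ G.T0
  T_pos : ∀ j, 0 < G.T j
  TN_pos : 0 < G.TN
  M_lt : G.M < Mbar
  nhds : Ω ∈ 𝓝ˢ (Icc 0 Mbar)
  strictMono : ∀ r, StrictMonoOn (G.c r) Ω
  convex : ∀ r, ConvexOn ℝ Ω (G.c r)
  contDiff : ∀ r, ContDiffOn ℝ 1 (G.c r) Ω
  nonneg : ∀ r, ∀ t ∈ Icc 0 Mbar, 0 ≤ G.c r t

/-- The condition that makes the first arc the less costly one at equilibrium. -/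
def FirstArcCheaper : Prop :=
  G.c 0 G.M < G.c 1 0 ∨
    (G.c 1 0 ≤ G.c 0 G.M ∧ G.c 0 0 ≤ G.c 1 G.M ∧
      ∃ ξ ∈ Icc 0 G.M, G.c 0 ξ = G.c 1 (G.M - ξ) ∧
        (G.M - ξ) * deriv (G.c 1) (G.M - ξ) ≤ ξ * deriv (G.c 0) ξ)

/-! ### Unilateral decentralization -/

/-- `z` is a composite equilibrium of the game induced by the decentralization strategy `α`: the
nonatomic deputies join the other nonatomic players, and the atomic players are the atomic deputies
together with the atomic opponents. -/
def IsInducedCE (α : DecentralizationStrategy G.TN) (z : Flow (Fin α.n ⊕ Fin G.k)) : Prop :=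
  IsCE G.c (α.weight0 + G.T0) (Sum.elim α.weight G.T) z

/-- Total cost to the deputies at the flow `z` when the part `p` of the nonatomic flow is the flow
of the nonatomic deputies. -/
def deputiesCost {n : ℕ} (z : Flow (Fin n ⊕ Fin G.k)) (p : Fin 2 → ℝ) : ℝ :=
  ∑ r, (p r + ∑ i, z.atomic (Sum.inl i) r) * G.c r (z.load r)

/-- `u` is the cost of the decentralizing player when she plays `α`: the total cost to her deputies
at a composite equilibrium of the induced game, whose nonatomic flow is split into the flow `p` of
her nonatomic deputies and that of the nonatomic opponents. -/
def IsDecentralizationCost (α : DecentralizationStrategy G.TN) (u : ℝ) : Prop :=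
  ∃ z, G.IsInducedCE α z ∧ ∃ p ∈ feasible α.weight0, z.nonatomic - p ∈ feasible G.T0 ∧
    u = G.deputiesCost z p

/-- `α` minimizes the cost of the decentralizing player over all decentralization strategies. -/
def IsOptimalDecentralization (α : DecentralizationStrategy G.TN) : Prop :=
  ∃ u, G.IsDecentralizationCost α u ∧
    ∀ (β : DecentralizationStrategy G.TN) (v : ℝ), G.IsDecentralizationCost β v → u ≤ v

/-! ### The Stackelberg game -/

/-- `z` is a composite equilibrium of the followers' game given the leader's flow `x`: the followers
play the composite congestion game in which the cost of arc `r` at followers' load `t` is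
`c r (x r + t)`. -/
def IsFollowersCE (x : Fin 2 → ℝ) (z : Flow (Fin G.k)) : Prop :=
  IsCE (fun r t => G.c r (x r + t)) G.T0 G.T z

/-- The leader's cost when she plays `x` and the followers' flow is `z`. -/
def leaderCost (x : Fin 2 → ℝ) (z : Flow (Fin G.k)) : ℝ :=
  ∑ r, x r * G.c r (x r + z.load r)

/-- The leader's flow `x` and the followers' plan `Z` (a flow after each flow of the leader) form a
subgame perfect equilibrium. -/
structure IsSPNE (x : Fin 2 → ℝ) (Z : (Fin 2 → ℝ) → Flow (Fin G.k)) : Prop where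
  leader_mem : x ∈ feasible G.TN
  followers : ∀ x' ∈ feasible G.TN, G.IsFollowersCE x' (Z x')
  leader_opt : ∀ x' ∈ feasible G.TN, G.leaderCost x (Z x) ≤ G.leaderCost x' (Z x')

end Game

end CompositeCongestion

end

/-! Decentralizing and leading give player $N$ the same attainable optimum. At the CE induced by a
decentralization, the deputies send some aggregate flow $x$, and the opponents' first-order
conditions depend only on the total loads. So they play the followers' CE after $x$, and no
decentralization beats an SPNE (`leaderCost_le`).

Conversely, an optimal $x$ is the outcome of a decentralization (`exists_isDecentralizationCost`).
If $x$ uses only arcs of minimal price, nonatomic deputies suffice. Otherwise arc $r$ is strictly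
cheaper than $s$ and $x_s>0$. Optimality forces $p_s+x_sq_s\le p_r+x_rq_r$ for prices $p$ and slopes
$q$ (`marginal_le_of_isSPNE`). Hence some $a\in(0,x_r]$ equalizes $p_r+aq_r=p_s+x_sq_s$: one atomic
deputy sends $a$ on $r$ and $x_s$ on $s$, and nonatomic deputies send $x_r-a$ on $r$.

The inequality rests on comparative statics (`add_load_mem_Icc`): when the leader moves weight to an
arc, its load rises by at most that weight. The same estimate gives uniqueness of the CE and
continuity of the leader's cost, hence an SPNE. -/

noncomputable section

namespace CompositeCongestion

/-! ### Regular arc costs -/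

/-- `d` is an arc cost on `[0, W]` with derivative `d'`: the derivative is positive and continuous,
and `d` lies above its tangents. -/
structure RegularCost (d d' : ℝ → ℝ) (W : ℝ) : Prop where
  hasDerivAt : ∀ t ∈ Icc 0 W, HasDerivAt d (d' t) t
  deriv_pos : ∀ t ∈ Icc 0 W, 0 < d' t
  continuousOn_deriv : ContinuousOn d' (Icc 0 W)
  tangent : ∀ t ∈ Icc 0 W, ∀ u ∈ Icc 0 W, d t + (u - t) * d' t ≤ d u

namespace RegularCost

variable {d d' : ℝ → ℝ} {W : ℝ}

theorem continuousOn (h : RegularCost d d' W) : ContinuousOn d (Icc 0 W) :=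
  fun t ht => (h.hasDerivAt t ht).continuousAt.continuousWithinAt

theorem strictMonoOn (h : RegularCost d d' W) : StrictMonoOn d (Icc 0 W) := by
  intro t ht u hu htu
  have h1 := h.tangent t ht u hu
  have h2 := mul_pos (sub_pos.2 htu) (h.deriv_pos t ht)
  linarith

theorem monotoneOn_deriv (h : RegularCost d d' W) : MonotoneOn d' (Icc 0 W) := by
  intro t ht u hu htu
  rcases htu.eq_or_lt with rfl | htu
  · exact le_rfl
  have h1 := h.tangent t ht u hu
  have h2 := h.tangent u hu t ht
  by_contra! hlt
  nlinarith

theorem shift (h : RegularCost d d' W) {x V : ℝ} (hx : 0 ≤ x) (hV : x + V ≤ W) :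
    RegularCost (fun t => d (x + t)) (fun t => d' (x + t)) V := by
  have hmem : ∀ t ∈ Icc 0 V, x + t ∈ Icc 0 W := fun t ht =>
    ⟨add_nonneg hx ht.1, by linarith [ht.2]⟩
  refine ⟨fun t ht => ?_, fun t ht => h.deriv_pos _ (hmem t ht), ?_, fun t ht u hu => ?_⟩
  · exact (h.hasDerivAt _ (hmem t ht)).comp_const_add x t
  · exact h.continuousOn_deriv.comp (by fun_prop) hmem
  · have := h.tangent _ (hmem t ht) _ (hmem u hu)
    rwa [add_sub_add_left_eq_sub] at this

theorem mono (h : RegularCost d d' W) {V : ℝ} (hV : V ≤ W) : RegularCost d d' V := by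
  simpa using h.shift le_rfl (by simpa using hV)

end RegularCost

theorem regularCost_of_convexOn {f : ℝ → ℝ} {Ω : Set ℝ} {W : ℝ} (hΩ : Ω ∈ 𝓝ˢ (Icc 0 W))
    (hmono : StrictMonoOn f Ω) (hconv : ConvexOn ℝ Ω f) (hsmooth : ContDiffOn ℝ 1 f Ω) :
    RegularCost f (deriv f) W := by
  have hnhds : ∀ t ∈ Icc 0 W, Ω ∈ 𝓝 t := mem_nhdsSet_iff_forall.1 hΩ
  have hdiff : ∀ t ∈ Icc 0 W, HasDerivAt f (deriv f t) t := fun t ht =>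
    ((hsmooth.contDiffAt (hnhds t ht)).differentiableAt one_ne_zero).hasDerivAt
  have hmem : ∀ t ∈ Icc 0 W, t ∈ Ω := fun t ht => mem_of_mem_nhds (hnhds t ht)
  have htan : ∀ t ∈ Icc 0 W, ∀ u ∈ Ω, f t + (u - t) * deriv f t ≤ f u := by
    intro t ht u hu
    rcases lt_trichotomy u t with hut | rfl | hut
    · have := hconv.slope_le_of_hasDerivAt hu (hmem t ht) hut (hdiff t ht)
      rw [slope_def_field, div_le_iff₀ (sub_pos.2 hut)] at this
      linarith
    · simp
    · have := hconv.le_slope_of_hasDerivAt (hmem t ht) hu hut (hdiff t ht)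
      rw [slope_def_field, le_div_iff₀ (sub_pos.2 hut)] at this
      linarith
  refine ⟨hdiff, fun t ht => ?_, ?_, fun t ht u hu => htan t ht u (hmem u hu)⟩
  -- The comparison point lies to the left of `t`, perhaps outside `[0, W]`; this is why `htan` lets
  -- `u` range over `Ω`.
  · obtain ⟨l, hl, hlΩ⟩ := exists_Ioc_subset_of_mem_nhds (hnhds t ht) ⟨t - 1, by linarith⟩
    have hm : (l + t) / 2 ∈ Ω := hlΩ ⟨by linarith, by linarith⟩
    have h1 := htan t ht _ hm
    have h2 := hmono hm (hmem t ht) (by linarith)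
    by_contra! hle
    nlinarith
  · have hopen : ContinuousOn (deriv f) (interior Ω) :=
      (hsmooth.mono interior_subset).continuousOn_deriv_of_isOpen isOpen_interior le_rfl
    exact hopen.mono fun t ht => mem_interior_iff_mem_nhds.2 (hnhds t ht)

/-! ### Flows on two arcs and one-sided derivatives -/

theorem sum_fin_two_of_ne {r s : Fin 2} (hrs : r ≠ s) (f : Fin 2 → ℝ) : ∑ a, f a = f r + f s := by
  rw [← Finset.sum_pair hrs]
  congr 1
  ext a
  simp only [Finset.mem_univ, Finset.mem_insert, Finset.mem_singleton, true_iff]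
  omega

theorem mem_feasible_iff {r s : Fin 2} (hrs : r ≠ s) {w : ℝ} {x : Fin 2 → ℝ} :
    x ∈ feasible w ↔ 0 ≤ x r ∧ 0 ≤ x s ∧ x r + x s = w := by
  simp only [feasible, mem_ofPred_eq, sum_fin_two_of_ne hrs]
  constructor
  · rintro ⟨h, h'⟩
    exact ⟨h r, h s, h'⟩
  · rintro ⟨h1, h2, h3⟩
    refine ⟨fun a => ?_, h3⟩
    obtain rfl | rfl : a = r ∨ a = s := by omega
    exacts [h1, h2]

theorem forall_fin_two_of_ne {r s : Fin 2} (hrs : r ≠ s) {P : Fin 2 → Prop} (hr : P r) (hs : P s)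
    (a : Fin 2) : P a := by
  obtain rfl | rfl : a = r ∨ a = s := by omega
  exacts [hr, hs]

theorem exists_forall_lt_of_deriv_neg {ψ : ℝ → ℝ} {m : ℝ} (hψ : HasDerivAt ψ m 0) (hm : m < 0) :
    ∃ b > 0, ∀ h ∈ Ioo 0 b, ψ h < ψ 0 := by
  have h1 := (hasDerivWithinAt_iff_tendsto_slope' self_notMem_Ioi).1
    (hψ.hasDerivWithinAt (s := Ioi 0))
  obtain ⟨b, hb, hsub⟩ := (mem_nhdsGT_iff_exists_Ioo_subset (a := (0 : ℝ))).1
    (h1.eventually_lt_const hm)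
  refine ⟨b, hb, fun h hh => ?_⟩
  have := hsub hh
  simp only [mem_ofPred_eq, slope_def_field, sub_zero] at this
  rw [div_lt_iff₀ hh.1] at this
  linarith

/-- A derivative is nonnegative at a minimum over a right neighbourhood. -/
theorem deriv_nonneg_of_forall_le {ψ : ℝ → ℝ} {m b : ℝ} (hψ : HasDerivAt ψ m 0) (hb : 0 < b)
    (hmin : ∀ h ∈ Ioo 0 b, ψ 0 ≤ ψ h) : 0 ≤ m := by
  by_contra! hm
  obtain ⟨b', hb', hlt⟩ := exists_forall_lt_of_deriv_neg hψ hm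
  obtain ⟨h, h0, h1⟩ := exists_between (lt_min hb hb')
  exact absurd (hlt h ⟨h0, h1.trans_le (min_le_right _ _)⟩)
    (hmin h ⟨h0, h1.trans_le (min_le_left _ _)⟩).not_gt

/-! ### First-order characterization of equilibria -/

/-- The first-order conditions of a composite equilibrium when the costs of the arcs are `p` and
their slopes are `q`. -/
structure IsStationary {ι : Type} (p q : Fin 2 → ℝ) (T0 : ℝ) (T : ι → ℝ) (z : Flow ι) :
    Prop where
  nonatomic_mem : z.nonatomic ∈ feasible T0
  atomic_mem : ∀ i, z.atomic i ∈ feasible (T i)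
  wardrop : ∀ r, 0 < z.nonatomic r → ∀ s, p r ≤ p s
  marginal : ∀ i r, 0 < z.atomic i r → ∀ s,
    p r + z.atomic i r * q r ≤ p s + z.atomic i s * q s

section Equilibrium

variable {ι : Type} [Fintype ι]

theorem Flow.load_nonneg {T0 : ℝ} {T : ι → ℝ} {z : Flow ι} (h0 : z.nonatomic ∈ feasible T0)
    (h : ∀ i, z.atomic i ∈ feasible (T i)) (r : Fin 2) : 0 ≤ z.load r :=
  add_nonneg (h0.1 r) (Finset.sum_nonneg fun i _ => (h i).1 r)

theorem Flow.sum_load {T0 : ℝ} {T : ι → ℝ} {z : Flow ι} (h0 : z.nonatomic ∈ feasible T0)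
    (h : ∀ i, z.atomic i ∈ feasible (T i)) : ∑ r, z.load r = T0 + ∑ i, T i := by
  simp only [Flow.load, Finset.sum_add_distrib]
  rw [Finset.sum_comm, h0.2, Finset.sum_congr rfl fun i _ => (h i).2]

theorem Flow.load_mem_Icc {T0 : ℝ} {T : ι → ℝ} {z : Flow ι} (h0 : z.nonatomic ∈ feasible T0)
    (h : ∀ i, z.atomic i ∈ feasible (T i)) (r : Fin 2) : z.load r ∈ Icc 0 (T0 + ∑ i, T i) := by
  refine ⟨Flow.load_nonneg h0 h r, ?_⟩
  rw [← Flow.sum_load h0 h]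
  exact Finset.single_le_sum (fun s _ => Flow.load_nonneg h0 h s) (Finset.mem_univ r)

variable [DecidableEq ι]

theorem Flow.load_deviate (z : Flow ι) (i : ι) (y : Fin 2 → ℝ) (r : Fin 2) :
    (z.deviate i y).load r = z.load r + (y r - z.atomic i r) := by
  simp only [Flow.load, Flow.deviate]
  rw [← Finset.add_sum_erase _ _ (Finset.mem_univ i),
    ← Finset.add_sum_erase Finset.univ (fun j => z.atomic j r) (Finset.mem_univ i),
    Finset.sum_congr rfl fun j hj => by rw [Function.update_of_ne (Finset.ne_of_mem_erase hj)]]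
  simp
  ring

theorem Flow.atomicCost_deviate (c : Fin 2 → ℝ → ℝ) (z : Flow ι) (i : ι) (y : Fin 2 → ℝ) :
    (z.deviate i y).atomicCost c i = ∑ r, y r * c r (z.load r + (y r - z.atomic i r)) := by
  simp only [Flow.atomicCost, Flow.load_deviate]
  simp [Flow.deviate]

variable {d d' : Fin 2 → ℝ → ℝ} {T0 : ℝ} {T : ι → ℝ} {z : Flow ι}

theorem IsStationary.isCE (hd : ∀ r, RegularCost (d r) (d' r) (T0 + ∑ i, T i))
    (hz : IsStationary (fun r => d r (z.load r)) (fun r => d' r (z.load r)) T0 T z) :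
    IsCE d T0 T z := by
  refine ⟨hz.nonatomic_mem, hz.atomic_mem, hz.wardrop, fun i y hy => ?_⟩
  rw [Flow.atomicCost_deviate, Flow.atomicCost]
  have hload := fun r => Flow.load_mem_Icc hz.nonatomic_mem hz.atomic_mem r
  have hx := hz.atomic_mem i
  have hdev : (z.deviate i y).load 0 ∈ Icc 0 (T0 + ∑ i, T i) ∧
      (z.deviate i y).load 1 ∈ Icc 0 (T0 + ∑ i, T i) := by
    have hm : ∀ j, (z.deviate i y).atomic j ∈ feasible (T j) := by
      intro j
      by_cases hj : j = i
      · subst hj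
        simpa [Flow.deviate] using hy
      · simpa [Flow.deviate, Function.update_of_ne hj] using hz.atomic_mem j
    exact ⟨Flow.load_mem_Icc (z := z.deviate i y) hz.nonatomic_mem hm 0,
      Flow.load_mem_Icc (z := z.deviate i y) hz.nonatomic_mem hm 1⟩
  rw [Flow.load_deviate, Flow.load_deviate] at hdev
  -- The tangent inequality bounds the cost of `y` on each arc below by an affine function of `y r`
  -- with the marginal cost as slope; the discarded term is $(y_r-x_r)^2d_r'\ge 0$. Stationarity
  -- makes the sum of the affine increments nonnegative.
  have key : ∀ r, z.load r + (y r - z.atomic i r) ∈ Icc 0 (T0 + ∑ i, T i) →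
      z.atomic i r * d r (z.load r) + (y r - z.atomic i r) *
        (d r (z.load r) + z.atomic i r * d' r (z.load r)) ≤
      y r * d r (z.load r + (y r - z.atomic i r)) := by
    intro r hr
    have h1 := mul_le_mul_of_nonneg_left ((hd r).tangent _ (hload r) _ hr) (hy.1 r)
    have h2 := mul_nonneg (sq_nonneg (y r - z.atomic i r)) ((hd r).deriv_pos _ (hload r)).le
    linear_combination h1 + h2
  have k0 := key 0 hdev.1
  have k1 := key 1 hdev.2
  have m0 := hz.marginal i 0
  have m1 := hz.marginal i 1
  rw [mem_feasible_iff zero_ne_one] at hx hy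
  simp only [Fin.sum_univ_two]
  obtain ⟨hx0, hx1, hxw⟩ := hx
  obtain ⟨hy0, hy1, hyw⟩ := hy
  have : 0 ≤ (y 0 - z.atomic i 0) * ((d 0 (z.load 0) + z.atomic i 0 * d' 0 (z.load 0)) -
      (d 1 (z.load 1) + z.atomic i 1 * d' 1 (z.load 1))) := by
    rcases lt_trichotomy (y 0) (z.atomic i 0) with h | h | h
    · have := m0 (by linarith) 1
      exact mul_nonneg_of_nonpos_of_nonpos (by linarith) (by linarith)
    · simp [h]
    · have := m1 (by linarith) 0
      exact mul_nonneg (by linarith) (by linarith)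
  have e : y 1 - z.atomic i 1 = -(y 0 - z.atomic i 0) := by linarith
  rw [e] at k1
  rw [e]
  linarith

theorem IsCE.isStationary (hd : ∀ r, RegularCost (d r) (d' r) (T0 + ∑ i, T i))
    (hz : IsCE d T0 T z) :
    IsStationary (fun r => d r (z.load r)) (fun r => d' r (z.load r)) T0 T z := by
  refine ⟨hz.nonatomic_mem, hz.atomic_mem, hz.wardrop, fun i r hr s => ?_⟩
  rcases eq_or_ne r s with rfl | hrs
  · exact le_rfl
  have hload := fun r => Flow.load_mem_Icc hz.nonatomic_mem hz.atomic_mem r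
  -- Player `i` shifts a weight `h` from arc `r` to arc `s`.
  have hderiv : HasDerivAt (fun h => (z.atomic i r - h) * d r (z.load r - h) +
      (z.atomic i s + h) * d s (z.load s + h))
      (-(d r (z.load r) + z.atomic i r * d' r (z.load r)) +
        (d s (z.load s) + z.atomic i s * d' s (z.load s))) 0 := by
    have h1 : HasDerivAt (fun h => d r (z.load r - h)) (-d' r (z.load r)) 0 :=
      HasDerivAt.comp_const_sub _ _ (by simpa using (hd r).hasDerivAt _ (hload r))
    have h2 : HasDerivAt (fun h => d s (z.load s + h)) (d' s (z.load s)) 0 :=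
      HasDerivAt.comp_const_add _ _ (by simpa using (hd s).hasDerivAt _ (hload s))
    have h3 := ((hasDerivAt_id (0 : ℝ)).const_sub (z.atomic i r)).mul h1
    have h4 := ((hasDerivAt_id (0 : ℝ)).const_add (z.atomic i s)).mul h2
    refine (h3.add h4).congr_deriv ?_
    simp
    ring
  have := deriv_nonneg_of_forall_le hderiv hr fun h hh => by
    have hx := (mem_feasible_iff hrs).1 (hz.atomic_mem i)
    let y : Fin 2 → ℝ := Function.update (fun _ => z.atomic i s + h) r (z.atomic i r - h)
    have yr : y r = z.atomic i r - h := by simp [y]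
    have ys : y s = z.atomic i s + h := by simp [y, Function.update_of_ne hrs.symm]
    have hy : y ∈ feasible (T i) := by
      rw [mem_feasible_iff hrs, yr, ys]
      exact ⟨by linarith [hh.2], by linarith [hh.1], by linarith⟩
    have hc := hz.nash i y hy
    rw [Flow.atomicCost_deviate, Flow.atomicCost, sum_fin_two_of_ne hrs, sum_fin_two_of_ne hrs,
      yr, ys] at hc
    convert hc using 1
    · simp
    · congr 3 <;> ring_nf
  linarith

end Equilibrium

/-! ### Comparative statics and uniqueness -/

/-- A player sending strictly more on `r` sends less on `s`, so her marginal cost rises strictly on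
`r` and does not rise on `s`. But stationarity of `z` requires that of `s` to be at most that of
`r`, and stationarity of `z'` the reverse. -/
theorem IsStationary.atomic_le {ι : Type} {p q p' q' : Fin 2 → ℝ} {T0 : ℝ} {T : ι → ℝ}
    {z z' : Flow ι} (hz : IsStationary p q T0 T z) (hz' : IsStationary p' q' T0 T z')
    {r s : Fin 2} (hrs : r ≠ s) (hq : 0 < q r) (hq' : 0 < q' s) (hp_r : p r ≤ p' r)
    (hq_r : q r ≤ q' r) (hp_s : p' s ≤ p s) (hq_s : q' s ≤ q s) (i : ι) :
    z'.atomic i r ≤ z.atomic i r := by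
  by_contra! hlt
  have hx := (mem_feasible_iff hrs).1 (hz.atomic_mem i)
  have hx' := (mem_feasible_iff hrs).1 (hz'.atomic_mem i)
  have h1 := hz.marginal i s (by linarith) r
  have h2 := hz'.marginal i r (by linarith) s
  have h3 := mul_lt_mul_of_pos_right hlt hq
  have h4 := mul_le_mul_of_nonneg_left hq_r hx'.1
  have h5 : z'.atomic i s * q' s ≤ z.atomic i s * q' s :=
    mul_le_mul_of_nonneg_right (by linarith) hq'.le
  have h6 := mul_le_mul_of_nonneg_left hq_s hx.2.1
  linarith

/-- Here no slope term supplies strictness, so the price of `r` has to rise strictly. -/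
theorem IsStationary.nonatomic_le {ι : Type} {p q p' q' : Fin 2 → ℝ} {T0 : ℝ} {T : ι → ℝ}
    {z z' : Flow ι} (hz : IsStationary p q T0 T z) (hz' : IsStationary p' q' T0 T z')
    {r s : Fin 2} (hrs : r ≠ s) (hp_r : p r < p' r) (hp_s : p' s ≤ p s) :
    z'.nonatomic r ≤ z.nonatomic r := by
  by_contra! hlt
  have hx := (mem_feasible_iff hrs).1 hz.nonatomic_mem
  have hx' := (mem_feasible_iff hrs).1 hz'.nonatomic_mem
  have h1 := hz.wardrop s (by linarith) r
  have h2 := hz'.wardrop r (by linarith) s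
  linarith

section Comparison

variable {ι : Type} [Fintype ι] {c c' : Fin 2 → ℝ → ℝ} {W T0 : ℝ} {T : ι → ℝ}
  {x x' : Fin 2 → ℝ} {z z' : Flow ι}

/-- If the load of arc `r` increases and that of the other arc decreases, then the players move away
from arc `r`. -/
theorem load_le_of_add_load_lt (hc : ∀ r, RegularCost (c r) (c' r) W)
    (hz : IsStationary (fun r => c r (x r + z.load r)) (fun r => c' r (x r + z.load r)) T0 T z)
    (hz' : IsStationary (fun r => c r (x' r + z'.load r)) (fun r => c' r (x' r + z'.load r)) T0 T z')
    (hmem : ∀ r, x r + z.load r ∈ Icc 0 W) (hmem' : ∀ r, x' r + z'.load r ∈ Icc 0 W)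
    {r s : Fin 2} (hrs : r ≠ s) (hr : x r + z.load r < x' r + z'.load r)
    (hs : x' s + z'.load s ≤ x s + z.load s) : z'.load r ≤ z.load r := by
  have hat := hz.atomic_le hz' hrs ((hc r).deriv_pos _ (hmem r)) ((hc s).deriv_pos _ (hmem' s))
    ((hc r).strictMonoOn.monotoneOn (hmem r) (hmem' r) hr.le)
    ((hc r).monotoneOn_deriv (hmem r) (hmem' r) hr.le)
    ((hc s).strictMonoOn.monotoneOn (hmem' s) (hmem s) hs)
    ((hc s).monotoneOn_deriv (hmem' s) (hmem s) hs)
  have hnon := hz.nonatomic_le hz' hrs ((hc r).strictMonoOn (hmem r) (hmem' r) hr)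
    ((hc s).strictMonoOn.monotoneOn (hmem' s) (hmem s) hs)
  exact add_le_add hnon (Finset.sum_le_sum fun i _ => hat i)

/-- The load of arc `r` is a nondecreasing and nonexpanding function of the leader's flow on it. -/
theorem add_load_mem_Icc (hc : ∀ r, RegularCost (c r) (c' r) W)
    (hz : IsStationary (fun r => c r (x r + z.load r)) (fun r => c' r (x r + z.load r)) T0 T z)
    (hz' : IsStationary (fun r => c r (x' r + z'.load r)) (fun r => c' r (x' r + z'.load r)) T0 T z')
    (hmem : ∀ r, x r + z.load r ∈ Icc 0 W) (hmem' : ∀ r, x' r + z'.load r ∈ Icc 0 W)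
    {r s : Fin 2} (hrs : r ≠ s) (hx : x r ≤ x' r) (hsum : x r + x s = x' r + x' s) :
    x' r + z'.load r ∈ Icc (x r + z.load r) (x r + z.load r + (x' r - x r)) := by
  have h := Flow.sum_load hz.nonatomic_mem hz.atomic_mem
  have h' := Flow.sum_load hz'.nonatomic_mem hz'.atomic_mem
  rw [sum_fin_two_of_ne hrs] at h h'
  constructor
  -- If the load of `r` fell, the followers would move towards `r`; as the leader does too, the load
  -- could not fall.
  · by_contra! hlt
    have := load_le_of_add_load_lt hc hz' hz hmem' hmem hrs hlt (by linarith)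
    linarith
  · rcases le_or_gt (x' r + z'.load r) (x r + z.load r) with hle | hlt
    · linarith
    · have := load_le_of_add_load_lt hc hz hz' hmem hmem' hrs hlt (by linarith)
      linarith

theorem IsStationary.unique (hc : ∀ r, RegularCost (c r) (c' r) W)
    (hz : IsStationary (fun r => c r (z.load r)) (fun r => c' r (z.load r)) T0 T z)
    (hz' : IsStationary (fun r => c r (z'.load r)) (fun r => c' r (z'.load r)) T0 T z')
    (hmem : ∀ r, z.load r ∈ Icc 0 W) (hmem' : ∀ r, z'.load r ∈ Icc 0 W) : z = z' := by
  have hload : ∀ r, z'.load r = z.load r := by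
    intro r
    obtain ⟨s, hrs⟩ := exists_ne r
    -- With a leader who sends nothing, the interval of possible loads is a point.
    have := add_load_mem_Icc (x := 0) (x' := 0) hc (by simpa using hz) (by simpa using hz')
      (by simpa using hmem) (by simpa using hmem') hrs.symm le_rfl rfl
    simp only [Pi.zero_apply, zero_add, sub_self, add_zero, Icc_self, mem_singleton_iff] at this
    exact this
  have hl : z'.load = z.load := funext hload
  rw [hl] at hz'
  have hpos := fun r => (hc r).deriv_pos _ (hmem r)
  have hat : z.atomic = z'.atomic := by
    funext i r
    obtain ⟨s, hrs⟩ := exists_ne r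
    exact le_antisymm
      (hz'.atomic_le hz hrs.symm (hpos r) (hpos s) le_rfl le_rfl le_rfl le_rfl i)
      (hz.atomic_le hz' hrs.symm (hpos r) (hpos s) le_rfl le_rfl le_rfl le_rfl i)
  refine Flow.ext (funext fun r => ?_) hat
  have := hload r
  simp only [Flow.load, hat] at this
  linarith

end Comparison

/-! ### Existence of equilibria -/

section Existence

/-- The weight that a player of weight `w` sends on an arc of cost `p` and slope `q` when those of
the other arc are `p'` and `q'`. -/
def response (p q p' q' w : ℝ) : ℝ :=
  max 0 (min w ((w * q' + p' - p) / (q + q')))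

theorem response_mem {p q p' q' w : ℝ} (hw : 0 ≤ w) : response p q p' q' w ∈ Icc 0 w :=
  ⟨le_max_left _ _, max_le hw (min_le_left _ _)⟩

/-- The quotient in `response` equalizes the two marginal costs; a positive response does not exceed
it. -/
theorem marginal_le_of_response_pos {p q p' q' w : ℝ} (hq : 0 < q + q')
    (h : 0 < response p q p' q' w) :
    p + response p q p' q' w * q ≤ p' + (w - response p q p' q' w) * q' := by
  have h1 : response p q p' q' w ≤ (w * q' + p' - p) / (q + q') := by
    rw [response] at h ⊢
    rcases lt_max_iff.1 h with h | h
    · exact absurd h (lt_irrefl _)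
    · rw [max_eq_right h.le]
      exact min_le_right _ _
  rw [le_div_iff₀ hq] at h1
  linarith

theorem marginal_le_of_response_lt {p q p' q' w : ℝ} (hq : 0 < q + q')
    (h : response p q p' q' w < w) :
    p' + (w - response p q p' q' w) * q' ≤ p + response p q p' q' w * q := by
  have h1 : (w * q' + p' - p) / (q + q') ≤ response p q p' q' w := by
    rw [response] at h ⊢
    have h2 := (max_lt_iff.1 h).2
    rcases min_lt_iff.1 h2 with h3 | h3
    · exact absurd h3 (lt_irrefl _)
    · rw [min_eq_right h3.le]
      exact le_max_right _ _
  rw [div_le_iff₀ hq] at h1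
  linarith

variable {ι : Type} [Fintype ι] [DecidableEq ι] {d d' : Fin 2 → ℝ → ℝ} {T0 : ℝ} {T : ι → ℝ}

/-- The load `t` of the first arc fixes prices and slopes, hence the atomic responses `f t i`. It
remains to choose `t` so that nonatomic players can account for the difference; this is a
one-dimensional problem, solved by the intermediate value theorem. -/
theorem exists_isCE (hd : ∀ r, RegularCost (d r) (d' r) (T0 + ∑ i, T i)) (hT0 : 0 ≤ T0)
    (hT : ∀ i, 0 ≤ T i) : ∃ z, IsCE d T0 T z := by
  set W := T0 + ∑ i, T i with hW
  have hW0 : 0 ≤ W := add_nonneg hT0 (Finset.sum_nonneg fun i _ => hT i)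
  let f : ℝ → ι → ℝ := fun t i => response (d 0 t) (d' 0 t) (d 1 (W - t)) (d' 1 (W - t)) (T i)
  have hmem : ∀ t ∈ Icc 0 W, W - t ∈ Icc 0 W := fun t ht => ⟨by linarith [ht.2], by linarith [ht.1]⟩
  have hq : ∀ t ∈ Icc 0 W, 0 < d' 0 t + d' 1 (W - t) := fun t ht =>
    add_pos ((hd 0).deriv_pos t ht) ((hd 1).deriv_pos _ (hmem t ht))
  have hsub : ContinuousOn (fun t : ℝ => W - t) (Icc 0 W) := by fun_prop
  have hd1 := (hd 1).continuousOn.comp hsub hmem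
  have hd1' := (hd 1).continuousOn_deriv.comp hsub hmem
  have hf : ∀ i, ContinuousOn (fun t => f t i) (Icc 0 W) := fun i =>
    continuousOn_const.sup (continuousOn_const.inf
      ((((continuousOn_const.mul hd1').add hd1).sub (hd 0).continuousOn).div
        ((hd 0).continuousOn_deriv.add hd1') fun t ht => (hq t ht).ne'))
  have hS : ContinuousOn (fun t => ∑ i, f t i) (Icc 0 W) :=
    continuousOn_finsetSum _ fun i _ => hf i
  have hfm : ∀ t i, f t i ∈ Icc 0 (T i) := fun t i => response_mem (hT i)
  -- A zero of `h` encodes complementarity: $a=t-\sum_i f_i(t)$ lies in $[0,T^0]$, the first arc is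
  -- no dearer if $a>0$, and no cheaper if $a<T^0$.
  let h : ℝ → ℝ := fun t => max ((∑ i, f t i) - t)
    (min (d 1 (W - t) - d 0 t) ((∑ i, f t i) + T0 - t))
  have hcont : ContinuousOn h (Icc 0 W) :=
    (hS.sub continuousOn_id).sup
      ((hd1.sub (hd 0).continuousOn).inf ((hS.add continuousOn_const).sub continuousOn_id))
  have h0 : 0 ≤ h 0 := le_max_of_le_left
    (by simpa using Finset.sum_nonneg fun i _ => (hfm 0 i).1)
  have h1 : h W ≤ 0 := by
    have := Finset.sum_le_sum fun i (_ : i ∈ Finset.univ) => (hfm W i).2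
    exact max_le (by linarith) (min_le_of_right_le (by linarith))
  obtain ⟨t, ht, hzero⟩ := intermediate_value_Icc' hW0 hcont ⟨h1, h0⟩
  have hn : ∃ a ∈ Icc 0 T0, a + ∑ i, f t i = t ∧ (0 < a → d 0 t ≤ d 1 (W - t)) ∧
      (a < T0 → d 1 (W - t) ≤ d 0 t) := by
    have hle : (∑ i, f t i) - t ≤ 0 := (le_max_left _ _).trans hzero.le
    have hle' : min (d 1 (W - t) - d 0 t) ((∑ i, f t i) + T0 - t) ≤ 0 :=
      (le_max_right _ _).trans hzero.le
    rcases max_choice ((∑ i, f t i) - t) (min (d 1 (W - t) - d 0 t) ((∑ i, f t i) + T0 - t))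
      with he | he
    · have he0 : (∑ i, f t i) - t = 0 := he.symm.trans hzero
      refine ⟨0, ⟨le_rfl, hT0⟩, by linarith, fun h => absurd h (lt_irrefl _), fun h => ?_⟩
      rcases min_le_iff.1 hle' with h' | h' <;> linarith
    · have he0 : min (d 1 (W - t) - d 0 t) ((∑ i, f t i) + T0 - t) = 0 := he.symm.trans hzero
      have hA : 0 ≤ d 1 (W - t) - d 0 t := he0.ge.trans (min_le_left _ _)
      have hB : 0 ≤ (∑ i, f t i) + T0 - t := he0.ge.trans (min_le_right _ _)
      refine ⟨t - ∑ i, f t i, ⟨by linarith, by linarith⟩, by ring, fun _ => by linarith,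
        fun h => ?_⟩
      rcases min_le_iff.1 hle' with h' | h' <;> linarith
  obtain ⟨a, ha, hat, ha0, ha1⟩ := hn
  let z : Flow ι := ⟨![a, T0 - a], fun i => ![f t i, T i - f t i]⟩
  have hl0 : z.load 0 = t := by simpa [z, Flow.load] using hat
  have hl1 : z.load 1 = W - t := by
    simp [z, Flow.load, Finset.sum_sub_distrib]
    linarith
  refine ⟨z, IsStationary.isCE hd ⟨?_, fun i => ?_, ?_, fun i => ?_⟩⟩
  · rw [mem_feasible_iff zero_ne_one]
    exact ⟨ha.1, sub_nonneg.2 ha.2, by simp [z]⟩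
  · rw [mem_feasible_iff zero_ne_one]
    exact ⟨(hfm t i).1, sub_nonneg.2 (hfm t i).2, by simp [z]⟩
  · rw [Fin.forall_fin_two, Fin.forall_fin_two, Fin.forall_fin_two]
    simp only [hl0, hl1]
    exact ⟨fun h => ⟨le_rfl, ha0 h⟩, fun h => ⟨ha1 (sub_pos.1 h), le_rfl⟩⟩
  · rw [Fin.forall_fin_two, Fin.forall_fin_two, Fin.forall_fin_two]
    simp only [hl0, hl1]
    exact ⟨fun h => ⟨le_rfl, marginal_le_of_response_pos (hq t ht) h⟩,
      fun h => ⟨marginal_le_of_response_lt (hq t ht) (sub_pos.1 h), le_rfl⟩⟩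

theorem existsUnique_isCE (hd : ∀ r, RegularCost (d r) (d' r) (T0 + ∑ i, T i)) (hT0 : 0 ≤ T0)
    (hT : ∀ i, 0 ≤ T i) : ∃! z, IsCE d T0 T z := by
  obtain ⟨z, hz⟩ := exists_isCE hd hT0 hT
  exact ⟨z, hz, fun z' hz' => (hz'.isStationary hd).unique hd (hz.isStationary hd)
    (Flow.load_mem_Icc hz'.nonatomic_mem hz'.atomic_mem)
    (Flow.load_mem_Icc hz.nonatomic_mem hz.atomic_mem)⟩

end Existence

/-! ### Adding and splitting flows -/

theorem sub_mem_feasible {w v : ℝ} {x p : Fin 2 → ℝ} (hx : x ∈ feasible (w + v))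
    (hp : p ∈ feasible w) (hle : ∀ r, p r ≤ x r) : x - p ∈ feasible v := by
  refine ⟨fun r => sub_nonneg.2 (hle r), ?_⟩
  simp only [Pi.sub_apply, Finset.sum_sub_distrib, hx.2, hp.2]
  ring

theorem add_mem_feasible {w v : ℝ} {x p : Fin 2 → ℝ} (hx : x ∈ feasible w)
    (hp : p ∈ feasible v) : x + p ∈ feasible (w + v) :=
  ⟨fun r => add_nonneg (hx.1 r) (hp.1 r), by
    simp only [Pi.add_apply, Finset.sum_add_distrib, hx.2, hp.2]⟩

theorem sum_mem_feasible {ι : Type} [Fintype ι] {w : ι → ℝ} {y : ι → Fin 2 → ℝ}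
    (hy : ∀ i, y i ∈ feasible (w i)) : ∑ i, y i ∈ feasible (∑ i, w i) := by
  refine ⟨fun r => ?_, ?_⟩
  · rw [Finset.sum_apply]
    exact Finset.sum_nonneg fun i _ => (hy i).1 r
  · simp only [Finset.sum_apply]
    rw [Finset.sum_comm]
    exact Finset.sum_congr rfl fun i _ => (hy i).2

/-- A part of an aggregate flow can be split off. -/
theorem exists_split {w v : ℝ} (hw : 0 ≤ w) (hv : 0 ≤ v) {x : Fin 2 → ℝ}
    (hx : x ∈ feasible (w + v)) : ∃ p ∈ feasible w, x - p ∈ feasible v := by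
  have hx' := (mem_feasible_iff zero_ne_one).1 hx
  -- The part fills the first arc as far as possible.
  have hp : ![min w (x 0), w - min w (x 0)] ∈ feasible w :=
    (mem_feasible_iff zero_ne_one).2
      ⟨le_min hw hx'.1, sub_nonneg.2 (min_le_left _ _), by simp⟩
  refine ⟨_, hp, sub_mem_feasible hx hp (Fin.forall_fin_two.2 ⟨min_le_right _ _, ?_⟩)⟩
  have : w - x 1 ≤ min w (x 0) := le_min (by linarith) (by linarith)
  simpa using by linarith

/-- When only the arcs of minimal price are used, the cost of a part of the flow does not depend on
how it is split off. -/
theorem cost_split_unique {w v : ℝ} {x a b π : Fin 2 → ℝ}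
    (hπ : ∀ r, 0 < x r → ∀ s, π r ≤ π s) (ha : a ∈ feasible w) (ha' : x - a ∈ feasible v)
    (hb : b ∈ feasible w) (hb' : x - b ∈ feasible v) :
    ∑ r, a r * π r = ∑ r, b r * π r := by
  rw [mem_feasible_iff zero_ne_one] at ha ha' hb hb'
  simp only [Pi.sub_apply] at ha' hb'
  simp only [Fin.sum_univ_two]
  rcases eq_or_ne (a 0) (b 0) with h | h
  · have : a 1 = b 1 := by linarith
    rw [h, this]
  -- Two different splits leave room on both arcs, so both are used and have equal prices.
  · have hpos : 0 < x 0 ∧ 0 < x 1 := by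
      rcases lt_or_gt_of_ne h with h | h <;> constructor <;> linarith
    have : π 0 = π 1 := le_antisymm (hπ 0 hpos.1 1) (hπ 1 hpos.2 0)
    rw [this]
    linear_combination π 1 * (ha.2.2 - hb.2.2)

namespace DecentralizationStrategy

/-- All the deputies are nonatomic. -/
def ofNonatomic (w : ℝ) (hw : 0 ≤ w) : DecentralizationStrategy w where
  n := 0
  weight0 := w
  weight := Fin.elim0
  weight0_nonneg := hw
  weight_pos i := i.elim0
  weight_antitone i := i.elim0
  sum_eq := by simp

/-- There is one atomic deputy, of weight `b`. -/
def ofSingle (w b : ℝ) (hb : 0 < b) (hbw : b ≤ w) : DecentralizationStrategy w where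
  n := 1
  weight0 := w - b
  weight _ := b
  weight0_nonneg := sub_nonneg.2 hbw
  weight_pos _ := hb
  weight_antitone _ _ _ := le_rfl
  sum_eq := by simp

end DecentralizationStrategy

/-! ### The Stackelberg game -/

namespace Game

variable {G : Game}

/-- Prices of the arcs at the total load induced by the flows `x` and `z`. -/
def price (G : Game) (x : Fin 2 → ℝ) (z : Flow (Fin G.k)) (r : Fin 2) : ℝ :=
  G.c r (x r + z.load r)

/-- Slopes of the costs of the arcs at the total load induced by the flows `x` and `z`. -/
def slope (G : Game) (x : Fin 2 → ℝ) (z : Flow (Fin G.k)) (r : Fin 2) : ℝ :=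
  deriv (G.c r) (x r + z.load r)

/-- The weights and costs of `G` are such that its equilibria are governed by first-order
conditions. -/
structure IsRegular (G : Game) : Prop where
  T0_nonneg : 0 ≤ G.T0
  T_pos : ∀ j, 0 < G.T j
  TN_pos : 0 < G.TN
  cost : ∀ r, RegularCost (G.c r) (deriv (G.c r)) G.M

theorem Admissible.isRegular {Mbar : ℝ} {Ω : Set ℝ} (hG : G.Admissible Mbar Ω) : G.IsRegular :=
  ⟨hG.T0_nonneg, hG.T_pos, hG.TN_pos, fun r =>
    (regularCost_of_convexOn hG.nhds (hG.strictMono r) (hG.convex r) (hG.contDiff r)).mono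
      hG.M_lt.le⟩

namespace IsRegular

variable {x x' : Fin 2 → ℝ} {z z' : Flow (Fin G.k)} {p q : Fin 2 → ℝ}

theorem followers_cost (hG : G.IsRegular) (hx : x ∈ feasible G.TN) (r : Fin 2) :
    RegularCost (fun t => G.c r (x r + t)) (fun t => deriv (G.c r) (x r + t))
      (G.T0 + ∑ j, G.T j) := by
  refine (hG.cost r).shift (hx.1 r) ?_
  have := Finset.single_le_sum (fun s _ => hx.1 s) (Finset.mem_univ r)
  rw [hx.2] at this
  rw [Game.M]
  linarith

theorem existsUnique_followersCE (hG : G.IsRegular) (hx : x ∈ feasible G.TN) :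
    ∃! z, G.IsFollowersCE x z :=
  existsUnique_isCE (hG.followers_cost hx) hG.T0_nonneg fun j => (hG.T_pos j).le

theorem isStationary (hG : G.IsRegular) (hx : x ∈ feasible G.TN) (hz : G.IsFollowersCE x z) :
    IsStationary (G.price x z) (G.slope x z) G.T0 G.T z :=
  IsCE.isStationary (hG.followers_cost hx) hz

theorem isFollowersCE (hG : G.IsRegular) (hx : x ∈ feasible G.TN)
    (hz : IsStationary (G.price x z) (G.slope x z) G.T0 G.T z) : G.IsFollowersCE x z :=
  IsStationary.isCE (hG.followers_cost hx) hz

theorem add_load_mem (hx : x ∈ feasible G.TN)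
    (hz : IsStationary p q G.T0 G.T z) (r : Fin 2) : x r + z.load r ∈ Icc 0 G.M := by
  refine ⟨add_nonneg (hx.1 r) (Flow.load_nonneg hz.nonatomic_mem hz.atomic_mem r), ?_⟩
  have h1 := Finset.single_le_sum (fun s _ => hx.1 s) (Finset.mem_univ r)
  have h2 := (Flow.load_mem_Icc hz.nonatomic_mem hz.atomic_mem r).2
  rw [hx.2] at h1
  rw [Game.M]
  linarith

theorem slope_pos (hG : G.IsRegular) (hx : x ∈ feasible G.TN)
    (hz : IsStationary p q G.T0 G.T z) (r : Fin 2) : 0 < G.slope x z r :=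
  (hG.cost r).deriv_pos _ (add_load_mem hx hz r)

theorem add_load_mem_Icc (hG : G.IsRegular) (hx : x ∈ feasible G.TN) (hx' : x' ∈ feasible G.TN)
    (hz : G.IsFollowersCE x z) (hz' : G.IsFollowersCE x' z') {r : Fin 2} (hle : x r ≤ x' r) :
    x' r + z'.load r ∈ Icc (x r + z.load r) (x r + z.load r + (x' r - x r)) := by
  obtain ⟨s, hs⟩ := exists_ne r
  have hst := hG.isStationary hx hz
  have hst' := hG.isStationary hx' hz'
  refine CompositeCongestion.add_load_mem_Icc hG.cost hst hst' (add_load_mem hx hst)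
    (add_load_mem hx' hst') hs.symm hle ?_
  rw [((mem_feasible_iff hs.symm).1 hx).2.2, ((mem_feasible_iff hs.symm).1 hx').2.2]

theorem add_load_eq (hx : x ∈ feasible G.TN) (hz : G.IsFollowersCE x z) {r s : Fin 2}
    (hrs : r ≠ s) : x s + z.load s = G.M - (x r + z.load r) := by
  have h1 := Flow.sum_load hz.nonatomic_mem hz.atomic_mem
  rw [sum_fin_two_of_ne hrs] at h1
  have h2 := ((mem_feasible_iff hrs).1 hx).2.2
  rw [Game.M]
  linarith

/-- The load is a 1-Lipschitz function of the leader's weight `a` on the first arc, so her cost is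
continuous on a compact interval. -/
theorem exists_isSPNE (hG : G.IsRegular) : ∃ x Z, G.IsSPNE x Z := by
  classical
  have hex : ∀ x, ∃ z, x ∈ feasible G.TN → G.IsFollowersCE x z := fun x => by
    by_cases hx : x ∈ feasible G.TN
    · obtain ⟨z, hz, -⟩ := hG.existsUnique_followersCE hx
      exact ⟨z, fun _ => hz⟩
    -- Off the feasible flows the plan is unconstrained.
    · exact ⟨⟨0, 0⟩, fun h => absurd h hx⟩
  choose Z hZ using hex
  let X : ℝ → Fin 2 → ℝ := fun a => ![a, G.TN - a]
  have hX : ∀ a ∈ Icc 0 G.TN, X a ∈ feasible G.TN := fun a ha =>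
    (mem_feasible_iff zero_ne_one).2 ⟨ha.1, sub_nonneg.2 ha.2, by simp [X]⟩
  let ξ : ℝ → ℝ := fun a => X a 0 + (Z (X a)).load 0
  have hξm : ∀ a ∈ Icc 0 G.TN, ξ a ∈ Icc 0 G.M := fun a ha =>
    add_load_mem (hX a ha) (hG.isStationary (hX a ha) (hZ _ (hX a ha))) 0
  have hξ : ContinuousOn ξ (Icc 0 G.TN) := by
    refine (LipschitzOnWith.of_le_add_mul 1 fun a ha b hb => ?_).continuousOn
    rw [NNReal.coe_one, one_mul, Real.dist_eq]
    rcases le_total a b with hab | hab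
    · have := (hG.add_load_mem_Icc (hX a ha) (hX b hb) (hZ _ (hX a ha)) (hZ _ (hX b hb))
        (r := 0) hab).1
      have h0 := abs_nonneg (a - b)
      simp only [ξ]
      linarith
    · have := (hG.add_load_mem_Icc (hX b hb) (hX a ha) (hZ _ (hX b hb)) (hZ _ (hX a ha))
        (r := 0) hab).2
      have h0 := le_abs_self (a - b)
      have h1 : X a 0 - X b 0 = a - b := rfl
      simp only [ξ]
      linarith
  have hcost : ∀ a ∈ Icc 0 G.TN, G.leaderCost (X a) (Z (X a)) =
      a * G.c 0 (ξ a) + (G.TN - a) * G.c 1 (G.M - ξ a) := by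
    intro a ha
    rw [leaderCost, Fin.sum_univ_two, add_load_eq (hX a ha) (hZ _ (hX a ha)) zero_ne_one]
    rfl
  have hcont : ContinuousOn (fun a => a * G.c 0 (ξ a) + (G.TN - a) * G.c 1 (G.M - ξ a))
      (Icc 0 G.TN) := by
    refine (continuousOn_id.mul ((hG.cost 0).continuousOn.comp hξ hξm)).add
      ((continuousOn_const.sub continuousOn_id).mul
        ((hG.cost 1).continuousOn.comp (continuousOn_const.sub hξ) fun a ha => ?_))
    exact ⟨sub_nonneg.2 (hξm a ha).2, sub_le_self _ (hξm a ha).1⟩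
  obtain ⟨a, ha, hmin⟩ := isCompact_Icc.exists_isMinOn ⟨0, le_rfl, hG.TN_pos.le⟩ hcont
  refine ⟨X a, Z, hX a ha, hZ, fun x hx => ?_⟩
  have hx' := (mem_feasible_iff zero_ne_one).1 hx
  have hxa : x 0 ∈ Icc 0 G.TN := ⟨hx'.1, by linarith⟩
  have hxX : x = X (x 0) := by
    funext r
    fin_cases r
    · rfl
    · simp only [X]
      simpa using by linarith
  have := hmin hxa
  simp only [mem_ofPred_eq] at this
  rw [← hcost a ha, ← hcost _ hxa, ← hxX] at this
  exact this

/-- At an optimal flow of the leader, using an arc which is not the cheaper one is worthwhile in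
terms of marginal costs at fixed flows of the followers. -/
theorem marginal_le_of_isSPNE (hG : G.IsRegular) {Z : (Fin 2 → ℝ) → Flow (Fin G.k)}
    (hS : G.IsSPNE x Z) {r s : Fin 2} (hrs : r ≠ s)
    (hlt : G.price x (Z x) r < G.price x (Z x) s) (hxs : 0 < x s) :
    G.price x (Z x) s + x s * G.slope x (Z x) s ≤
      G.price x (Z x) r + x r * G.slope x (Z x) r := by
  have hx := hS.leader_mem
  have hz := hS.followers x hx
  have hmem := add_load_mem hx (hG.isStationary hx hz)
  have hx' := (mem_feasible_iff hrs).1 hx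
  by_contra! hneg
  simp only [price, slope] at hlt hneg
  set ξr := x r + (Z x).load r with hξr
  set ξs := x s + (Z x).load s with hξs
  have h1 : HasDerivAt (fun h => G.c r (ξr + h)) (deriv (G.c r) ξr) 0 :=
    HasDerivAt.comp_const_add _ _ (by simpa using (hG.cost r).hasDerivAt _ (hmem r))
  have h2 : HasDerivAt (fun h => G.c s (ξs - h)) (-deriv (G.c s) ξs) 0 :=
    HasDerivAt.comp_const_sub _ _ (by simpa using (hG.cost s).hasDerivAt _ (hmem s))
  -- This is the leader's cost after a shift of `h` from `s` to `r`, the followers' flows being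
  -- fixed.
  have hψ : HasDerivAt (fun h => (x r + h) * G.c r (ξr + h) + (x s - h) * G.c s (ξs - h))
      ((G.c r ξr + x r * deriv (G.c r) ξr) - (G.c s ξs + x s * deriv (G.c s) ξs)) 0 := by
    have h3 := ((hasDerivAt_id (0 : ℝ)).const_add (x r)).mul h1
    have h4 := ((hasDerivAt_id (0 : ℝ)).const_sub (x s)).mul h2
    refine (h3.add h4).congr_deriv ?_
    simp
    ring
  have hgap : ∀ᶠ h in 𝓝 (0 : ℝ), G.c r (ξr + h) < G.c s (ξs - h) :=
    h1.continuousAt.eventually_lt h2.continuousAt (by simpa using hlt)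
  obtain ⟨b, hb, hgap⟩ := Metric.eventually_nhds_iff.1 hgap
  obtain ⟨b', hb', hdecr⟩ := exists_forall_lt_of_deriv_neg hψ (by linarith)
  obtain ⟨h, h0, hh⟩ := exists_between (lt_min hxs (lt_min hb hb'))
  obtain ⟨hhx, hhb⟩ := lt_min_iff.1 hh
  obtain ⟨hhb, hhb'⟩ := lt_min_iff.1 hhb
  let y : Fin 2 → ℝ := Function.update (fun _ => x s - h) r (x r + h)
  have yr : y r = x r + h := by simp [y]
  have ys : y s = x s - h := by simp [y, Function.update_of_ne hrs.symm]
  have hy : y ∈ feasible G.TN := by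
    rw [mem_feasible_iff hrs, yr, ys]
    exact ⟨by linarith, by linarith, by linarith⟩
  have hzy := hS.followers y hy
  have hload := hG.add_load_mem_Icc hx hy hz hzy (r := r) (by linarith)
  -- The followers react, so the load of `r` really changes by some $k\in[0,h]$.
  obtain ⟨k, hk⟩ : ∃ k, y r + (Z y).load r = ξr + k := ⟨_, (add_sub_cancel _ _).symm⟩
  have hks : y s + (Z y).load s = ξs - k := by
    rw [add_load_eq hy hzy hrs, hk, hξs, add_load_eq hx hz hrs]
    ring
  rw [hk, ← hξr, yr] at hload
  have hk0 : 0 ≤ k := by linarith [hload.1]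
  have hkh : k ≤ h := by linarith [hload.2]
  have hopt := hS.leader_opt y hy
  rw [leaderCost, leaderCost, sum_fin_two_of_ne hrs, sum_fin_two_of_ne hrs, hk, hks, yr, ys,
    ← hξr, ← hξs] at hopt
  have hgapk := hgap (y := k) (by
    rw [Real.dist_eq, sub_zero, abs_of_nonneg hk0]
    linarith)
  -- The new cost is $\psi(k)-(h-k)\,(c_s(\xi_s-k)-c_r(\xi_r+k))$, where $\psi$ is the function
  -- differentiated in `hψ`. If $k>0$ then $\psi(k)<\psi(0)$; if $k=0$ the subtracted term is
  -- positive. Either way the leader gains.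
  have hprod := mul_nonneg (sub_nonneg.2 hkh) (sub_pos.2 hgapk).le
  rcases hk0.eq_or_lt with rfl | hkpos
  · have := mul_pos h0 (sub_pos.2 hgapk)
    simp only [add_zero, sub_zero] at this hopt
    linarith
  · have := hdecr k ⟨hkpos, by linarith⟩
    simp only [add_zero, sub_zero] at this
    linarith

end IsRegular

/-! ### Decentralization and its equivalence with leadership -/

theorem IsRegular.induced_cost (hG : G.IsRegular) (α : DecentralizationStrategy G.TN) (r : Fin 2) :
    RegularCost (G.c r) (deriv (G.c r))
      (α.weight0 + G.T0 + ∑ i, Sum.elim α.weight G.T i) := by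
  have hM : α.weight0 + G.T0 + ∑ i, Sum.elim α.weight G.T i = G.M := by
    have := α.sum_eq
    simp only [Fintype.sum_sum_type, Sum.elim_inl, Sum.elim_inr, Game.M]
    linarith
  exact hM ▸ hG.cost r

theorem IsRegular.existsUnique_inducedCE (hG : G.IsRegular)
    (α : DecentralizationStrategy G.TN) : ∃! z, G.IsInducedCE α z := by
  refine existsUnique_isCE (hG.induced_cost α) (add_nonneg α.weight0_nonneg hG.T0_nonneg) ?_
  rintro (i | j)
  exacts [(α.weight_pos i).le, (hG.T_pos j).le]

/-- The flow of all the deputies. -/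
def deputiesFlow {n : ℕ} (z : Flow (Fin n ⊕ Fin G.k)) (p : Fin 2 → ℝ) : Fin 2 → ℝ :=
  p + ∑ i, z.atomic (Sum.inl i)

/-- The flow of the opponents. -/
def opponentsFlow {n : ℕ} (z : Flow (Fin n ⊕ Fin G.k)) (p : Fin 2 → ℝ) : Flow (Fin G.k) where
  nonatomic := z.nonatomic - p
  atomic j := z.atomic (Sum.inr j)

theorem deputiesFlow_add_load {n : ℕ} (z : Flow (Fin n ⊕ Fin G.k)) (p : Fin 2 → ℝ) (r : Fin 2) :
    deputiesFlow z p r + (opponentsFlow z p).load r = z.load r := by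
  simp only [deputiesFlow, opponentsFlow, Flow.load, Pi.add_apply, Pi.sub_apply,
    Finset.sum_apply, Fintype.sum_sum_type]
  ring

theorem leaderCost_deputiesFlow {n : ℕ} (z : Flow (Fin n ⊕ Fin G.k)) (p : Fin 2 → ℝ) :
    G.leaderCost (deputiesFlow z p) (opponentsFlow z p) = G.deputiesCost z p := by
  simp only [leaderCost, deputiesCost, deputiesFlow_add_load]
  simp only [deputiesFlow, Pi.add_apply, Finset.sum_apply]

/-- The nonatomic flow may split between deputies and opponents in several ways, but by the Wardrop
condition all give the deputies the same cost. -/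
theorem IsRegular.existsUnique_decentralizationCost (hG : G.IsRegular)
    (α : DecentralizationStrategy G.TN) : ∃! u, G.IsDecentralizationCost α u := by
  obtain ⟨z, hz, huniq⟩ := hG.existsUnique_inducedCE α
  obtain ⟨p, hp, hp'⟩ := exists_split α.weight0_nonneg hG.T0_nonneg hz.nonatomic_mem
  refine ⟨G.deputiesCost z p, ⟨z, hz, p, hp, hp', rfl⟩, ?_⟩
  rintro _ ⟨z', hz', p', hq, hq', rfl⟩
  obtain rfl := huniq z' hz'
  have := cost_split_unique hz.wardrop hq hq' hp hp'
  simp only [deputiesCost, add_mul, Finset.sum_add_distrib, this]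

/-- Each decentralization amounts to some flow of the leader. -/
theorem IsRegular.exists_leaderCost_eq (hG : G.IsRegular) {α : DecentralizationStrategy G.TN}
    {u : ℝ} (hu : G.IsDecentralizationCost α u) :
    ∃ x ∈ feasible G.TN, ∃ z, G.IsFollowersCE x z ∧ u = G.leaderCost x z := by
  obtain ⟨z, hz, p, hp, hp', rfl⟩ := hu
  have hst : IsStationary _ _ _ _ z := IsCE.isStationary (hG.induced_cost α) hz
  have hx : deputiesFlow z p ∈ feasible G.TN := by
    have h := add_mem_feasible hp (sum_mem_feasible fun i => hst.atomic_mem (Sum.inl i))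
    simp only [Sum.elim_inl, α.sum_eq] at h
    exact h
  refine ⟨_, hx, opponentsFlow z p, hG.isFollowersCE hx ?_, (leaderCost_deputiesFlow z p).symm⟩
  unfold price slope
  simp only [deputiesFlow_add_load]
  refine ⟨hp', fun j => hst.atomic_mem (Sum.inr j), fun r hr s => hst.wardrop r ?_ s,
    fun j => hst.marginal (Sum.inr j)⟩
  simp only [opponentsFlow, Pi.sub_apply] at hr
  linarith [hp.1 r]

/-- A flow of the leader is the outcome of a decentralization if it splits into flows of the deputies
that satisfy the first-order conditions. -/
theorem IsRegular.isDecentralizationCost (hG : G.IsRegular) {x : Fin 2 → ℝ} {z : Flow (Fin G.k)}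
    (hx : x ∈ feasible G.TN) (hz : G.IsFollowersCE x z) (α : DecentralizationStrategy G.TN)
    (d : Flow (Fin α.n))
    (hd : IsStationary (G.price x z) (G.slope x z) α.weight0 α.weight d)
    (hsum : d.load = x) : G.IsDecentralizationCost α (G.leaderCost x z) := by
  have hst := hG.isStationary hx hz
  let y : Flow (Fin α.n ⊕ Fin G.k) := ⟨d.nonatomic + z.nonatomic, Sum.elim d.atomic z.atomic⟩
  have hdep : deputiesFlow y d.nonatomic = x := by
    rw [← hsum]
    funext r
    simp [deputiesFlow, Flow.load, y]
  have hopp : opponentsFlow y d.nonatomic = z := by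
    ext <;> simp [opponentsFlow, y]
  have hload : ∀ r, y.load r = x r + z.load r := fun r => by
    rw [← deputiesFlow_add_load y d.nonatomic, hdep, hopp]
  refine ⟨y, IsStationary.isCE (hG.induced_cost α) ?_, d.nonatomic, hd.nonatomic_mem, ?_, ?_⟩
  · simp only [hload]
    refine ⟨add_mem_feasible hd.nonatomic_mem hst.nonatomic_mem, ?_, fun r hr => ?_, ?_⟩
    · rintro (i | j)
      exacts [hd.atomic_mem i, hst.atomic_mem j]
    -- If the sum is positive on `r`, one of the two nonatomic flows is, and its own Wardrop
    -- condition applies.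
    · rcases lt_or_ge 0 (d.nonatomic r) with h | h
      · exact hd.wardrop r h
      · refine hst.wardrop r ?_
        simp only [y, Pi.add_apply] at hr
        linarith
    · rintro (i | j)
      exacts [hd.marginal i, hst.marginal j]
  · simpa [y] using hst.nonatomic_mem
  · rw [← leaderCost_deputiesFlow, hdep, hopp]

/-- Every optimal flow of the leader is the outcome of a decentralization. -/
theorem IsRegular.exists_isDecentralizationCost (hG : G.IsRegular) {x : Fin 2 → ℝ}
    {Z : (Fin 2 → ℝ) → Flow (Fin G.k)} (hS : G.IsSPNE x Z) :
    ∃ α, G.IsDecentralizationCost α (G.leaderCost x (Z x)) := by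
  have hx := hS.leader_mem
  have hz := hS.followers x hx
  have hst := hG.isStationary hx hz
  have hnonatomic : (∀ r, 0 < x r → ∀ s, G.price x (Z x) r ≤ G.price x (Z x) s) →
      ∃ α, G.IsDecentralizationCost α (G.leaderCost x (Z x)) := fun h =>
    ⟨.ofNonatomic G.TN hG.TN_pos.le, hG.isDecentralizationCost hx hz _ ⟨x, fun i => i.elim0⟩
      ⟨hx, fun i => i.elim0, h, fun i => i.elim0⟩
      (funext fun r => (congrArg (x r + ·) (Fin.sum_univ_zero fun i => (i.elim0 : Fin 2 → ℝ) r)).trans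
        (add_zero _))⟩
  have hne : ∀ r s, r ≠ s → G.price x (Z x) r < G.price x (Z x) s →
      ∃ α, G.IsDecentralizationCost α (G.leaderCost x (Z x)) := by
    intro r s hrs hlt
    have hx' := (mem_feasible_iff hrs).1 hx
    rcases hx'.2.1.eq_or_lt with hs | hs
    -- The leader uses only the cheaper arc.
    · refine hnonatomic (forall_fin_two_of_ne hrs ?_ fun h => absurd hs h.ne)
      exact fun _ => forall_fin_two_of_ne hrs le_rfl hlt.le
    · have hmarg := hG.marginal_le_of_isSPNE hS hrs hlt hs
      have hqr := hG.slope_pos hx hst r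
      have hqs := hG.slope_pos hx hst s
      set pr := G.price x (Z x) r
      set ps := G.price x (Z x) s
      set qr := G.slope x (Z x) r
      set qs := G.slope x (Z x) s
      -- `a` equalizes the deputy's marginal costs; `hmarg` gives `a ≤ x r`, which leaves a
      -- nonnegative remainder for the nonatomic deputies.
      obtain ⟨a, ha⟩ : ∃ a, a * qr = ps - pr + x s * qs := ⟨_, div_mul_cancel₀ _ hqr.ne'⟩
      have ha0 : 0 < a := by
        have := mul_pos hs hqs
        exact pos_of_mul_pos_left (by linarith) hqr.le
      have hax : a ≤ x r := le_of_mul_le_mul_right (by linarith) hqr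
      let y : Fin 2 → ℝ := Function.update (fun _ => x s) r a
      let p : Fin 2 → ℝ := Function.update (fun _ => 0) r (x r - a)
      have yr : y r = a := by simp [y]
      have ys : y s = x s := by simp [y, Function.update_of_ne hrs.symm]
      have pr' : p r = x r - a := by simp [p]
      have ps' : p s = 0 := by simp [p, Function.update_of_ne hrs.symm]
      refine ⟨.ofSingle G.TN (a + x s) (by linarith) (by linarith),
        hG.isDecentralizationCost hx hz _ ⟨p, fun _ => y⟩ ⟨?_, fun _ => ?_, ?_, fun _ => ?_⟩ ?_⟩
      · refine (mem_feasible_iff hrs).2 ?_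
        simp only [pr', ps', DecentralizationStrategy.ofSingle]
        exact ⟨by linarith, le_rfl, by linarith⟩
      · refine (mem_feasible_iff hrs).2 ?_
        simp only [yr, ys, DecentralizationStrategy.ofSingle]
        exact ⟨ha0.le, hs.le, trivial⟩
      · refine forall_fin_two_of_ne hrs (fun _ => ?_) fun h => absurd ps' h.ne'
        exact forall_fin_two_of_ne hrs le_rfl hlt.le
      · refine forall_fin_two_of_ne hrs (fun _ => ?_) fun _ => ?_ <;>
          refine forall_fin_two_of_ne hrs ?_ ?_ <;> simp only [yr, ys] <;> linarith
      · refine funext (forall_fin_two_of_ne hrs ?_ ?_)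
        · exact (congrArg (p r + ·) (Fin.sum_univ_one fun _ => y r)).trans (by simp [pr', yr])
        · exact (congrArg (p s + ·) (Fin.sum_univ_one fun _ => y s)).trans (by simp [ps', ys])
  rcases lt_trichotomy (G.price x (Z x) 0) (G.price x (Z x) 1) with h | h | h
  · exact hne 0 1 zero_ne_one h
  · refine hnonatomic fun r _ s => ?_
    fin_cases r <;> fin_cases s <;> first | exact le_rfl | exact h.le | exact h.ge
  · exact hne 1 0 one_ne_zero h

theorem IsRegular.leaderCost_le (hG : G.IsRegular) {x : Fin 2 → ℝ}
    {Z : (Fin 2 → ℝ) → Flow (Fin G.k)} (hS : G.IsSPNE x Z) {α : DecentralizationStrategy G.TN}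
    {u : ℝ} (hu : G.IsDecentralizationCost α u) : G.leaderCost x (Z x) ≤ u := by
  obtain ⟨y, hy, z, hz, rfl⟩ := hG.exists_leaderCost_eq hu
  rw [(hG.existsUnique_followersCE hy).unique hz (hS.followers y hy)]
  exact hS.leader_opt y hy

end Game

end CompositeCongestion

end

/-- In order: the equilibria and costs entering the definitions are well defined (in the followers'
game and in the decentralized game); the Stackelberg game has a subgame perfect equilibrium; an
optimal decentralization strategy exists; and the cost of every optimal decentralization strategy
equals the leader's cost at every subgame perfect equilibrium. -/
theorem theorem3 (G : CompositeCongestion.Game) (Mbar : ℝ) (Ω : Set ℝ)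
    (hG : G.Admissible Mbar Ω) (hcheap : G.FirstArcCheaper) :
    (∀ x ∈ CompositeCongestion.feasible G.TN, ∃! z, G.IsFollowersCE x z) ∧
    (∀ α : CompositeCongestion.DecentralizationStrategy G.TN,
      (∃! z, G.IsInducedCE α z) ∧ ∃! u, G.IsDecentralizationCost α u) ∧
    (∃ x Z, G.IsSPNE x Z) ∧
    (∃ α, G.IsOptimalDecentralization α) ∧
    (∀ α u, G.IsOptimalDecentralization α → G.IsDecentralizationCost α u →
      ∀ x Z, G.IsSPNE x Z → u = G.leaderCost x (Z x)) := by
  have hR := hG.isRegular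
  obtain ⟨x, Z, hS⟩ := hR.exists_isSPNE
  obtain ⟨α, hα⟩ := hR.exists_isDecentralizationCost hS
  refine ⟨fun x hx => hR.existsUnique_followersCE hx,
    fun α => ⟨hR.existsUnique_inducedCE α, hR.existsUnique_decentralizationCost α⟩,
    ⟨x, Z, hS⟩, ⟨α, _, hα, fun β v hv => hR.leaderCost_le hS hv⟩, ?_⟩
  rintro β u ⟨u', hu', hmin⟩ hu y Y hY
  obtain rfl := (hR.existsUnique_decentralizationCost β).unique hu hu'
  -- The cost at the given SPNE is itself attained by a decentralization, which `β` does at least as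
  -- well as.
  obtain ⟨γ, hγ⟩ := hR.exists_isDecentralizationCost hY
  exact le_antisymm (hmin γ _ hγ) (hR.leaderCost_le hY hu)
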